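/- Let $d<n$ be non-negative integers and let $P\subseteq\mathbb{R}^n$ be a $0/1$-polytope, i.e. the convex hull of a subset of $\{0,1\}^n$. A face of a polytope $P$ is a set $\{x\in P : c^{\top}x=\gamma\}$, where $c^{\top}x\le\gamma$ holds for all $x\in P$; write $V(P)$ for the set of vertices ($0$-dimensional faces) of $P$, and let $G_P$ be the graph with vertex set $V(P)$ in which two vertices are adjacent if the segment joining them is a $1$-dimensional face of $P$. For a graph $G$ and sets $S,T$ of vertices, $e_G(S,T)$ denotes the number of edges of $G$ with one endpoint in $S$ and the other in $T$. Let $\pi:\mathbb{R}^n\to\mathbb{R}^d$ be the projection onto the first $d$ coordinates and let $R=\pi(P)$, which is a $0/1$-polytope in $\mathbb{R}^d$. Let $A\subseteq V(P)$, $A^{\mathsf c}=V(P)\setminus A$, $B=\pi(A)$ and $B^{\mathsf c}=V(R)\setminus B$. For $x\in\{0,1\}^d$ let $P_x=\pi^{-1}(\{x\})\cap P$, and let $$M=\{x\in\{0,1\}^d : P_x\cap A\neq\emptyset \text{ and } P_x\cap A^{\mathsf c}\neq\emptyset\}.$$ Then $$e_{G_P}(A,A^{\mathsf c})\;\ge\;\max\bigl\{|M|,\;e_{G_R}(B,B^{\mathsf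 c})\bigr\}.$$ -/

import Mathlib

/-- The vertices `{0,1}^n` of the `n`-dimensional hypercube `Q^n`, as points of `ℝ^n`. -/
def cube (n : ℕ) : Set (Fin n → ℝ) := {x | ∀ i, x i = 0 ∨ x i = 1}

/-- A `0/1`-polytope in `ℝ^n`: the convex hull of a subset of `{0,1}^n`. -/
def IsZeroOnePolytope {n : ℕ} (P : Set (Fin n → ℝ)) : Prop :=
  ∃ S : Set (Fin n → ℝ), S ⊆ cube n ∧ P = convexHull ℝ S

/-- `F` is a face of `P`: for some `c` and `γ`, the inequality `cᵀx ≤ γ` is valid on `P`, and `F` is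
the set of points of `P` where it is tight. -/
def IsFace {n : ℕ} (P F : Set (Fin n → ℝ)) : Prop :=
  ∃ (c : Fin n → ℝ) (γ : ℝ), (∀ x ∈ P, c ⬝ᵥ x ≤ γ) ∧ F = {x ∈ P | c ⬝ᵥ x = γ}

/-- `F` is a `k`-face of `P`: a (non-empty) face whose affine span has dimension `k`. -/
def IsFaceOfDim {n : ℕ} (k : ℕ) (P F : Set (Fin n → ℝ)) : Prop :=
  IsFace P F ∧ F.Nonempty ∧ Module.finrank ℝ (affineSpan ℝ F).direction = k

/-- The vertices of `P`, i.e. the points `v` such that `{v}` is a `0`-face of `P`. -/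
def polytopeVertices {n : ℕ} (P : Set (Fin n → ℝ)) : Set (Fin n → ℝ) :=
  {v | IsFaceOfDim 0 P {v}}

/-- The graph `G_P` of `P`, as a graph whose vertex set is the set of vertices of `P`. Two vertices
are adjacent when the segment joining them is an edge (a `1`-face) of `P`. -/
def polytopeGraph {n : ℕ} (P : Set (Fin n → ℝ)) :
    (⊤ : SimpleGraph (Fin n → ℝ)).Subgraph where
  verts := polytopeVertices P
  Adj u v := u ∈ polytopeVertices P ∧ v ∈ polytopeVertices P ∧ IsFaceOfDim 1 P (segment ℝ u v)
  adj_sub := by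
    rintro u v ⟨-, -, -, -, h⟩
    rw [SimpleGraph.top_adj]
    rintro rfl
    rw [segment_same, direction_affineSpan, vectorSpan_singleton, finrank_bot] at h
    exact zero_ne_one h
  edge_vert h := h.1
  symm := ⟨fun u v h => ⟨h.2.1, h.1, segment_symm ℝ u v ▸ h.2.2⟩⟩

/-- `e_G(S, T)`: the number of edges of `G` with one endpoint in `S` and the other in `T`. -/
noncomputable def numEdgesBetween {V : Type*} {H : SimpleGraph V} (G : H.Subgraph)
    (S T : Set V) : ℕ∞ :=
  {e ∈ G.edgeSet | ∃ u ∈ S, ∃ v ∈ T, e = s(u, v)}.encard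

/-- The projection `ℝ^n → ℝ^d` onto the first `d` coordinates. -/
def projFirst {d n : ℕ} (h : d ≤ n) : (Fin n → ℝ) →ₗ[ℝ] (Fin d → ℝ) :=
  LinearMap.funLeft ℝ ℝ (Fin.castLE h)

/-- The fiber `P_x = π⁻¹({x}) ∩ P` of `x` in `P`. -/
def fiber {d n : ℕ} (h : d ≤ n) (P : Set (Fin n → ℝ)) (x : Fin d → ℝ) : Set (Fin n → ℝ) :=
  projFirst h ⁻¹' {x} ∩ P

/-- `M`: the set of `x ∈ {0,1}^d` whose fiber in `P` meets both `A` and `Aᶜ`, where `Aᶜ` is the set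
of vertices of `P` outside `A`. -/
def mixedFibers {d n : ℕ} (h : d ≤ n) (P A : Set (Fin n → ℝ)) : Set (Fin d → ℝ) :=
  {x ∈ cube d | (fiber h P x ∩ A).Nonempty ∧ (fiber h P x ∩ (polytopeVertices P \ A)).Nonempty}

/-! Faces are handled through their vertex sets, as exposed subsets of a set `S` of cube vertices.
The engine is the simplex-method fact that a vertex not maximizing a functional over a face has an
improving edge inside that face (`exists_isExposedSubset_pair_improving`). For `x ∈ M`, the fiber
over `x` is a face meeting both `A` and its complement; an improving edge from a suitable vertex of
`A` leaves `A` within that fiber. For an edge `uv` of `R` with `u ∈ B`, `v ∉ B`, the part of `P`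
over `uv` is a face; an edge improving towards `v` joins a vertex of `A` over `u` to a vertex over
`v`, hence outside `A`. Either way the edge found projects back to `x` or to `uv`, so distinct
objects give distinct edges. -/

/-! ### Exposed subsets of cube vertices and improving edges -/

/-- `T` is the set of points of `S` at which some linear functional attains its maximum `γ`. -/
def IsExposedSubset {n : ℕ} (S T : Set (Fin n → ℝ)) : Prop :=
  T ⊆ S ∧ ∃ (c : Fin n → ℝ) (γ : ℝ), (∀ s ∈ T, c ⬝ᵥ s = γ) ∧ ∀ s ∈ S, s ∉ T → c ⬝ᵥ s < γ

theorem cube_finite (n : ℕ) : (cube n).Finite := by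
  have h : cube n = Set.pi Set.univ (fun _ => ({0, 1} : Set ℝ)) := by
    ext x
    simp [cube]
  rw [h]
  exact Set.Finite.pi' (fun _ => Set.toFinite _) |>.subset (by intro x hx i; exact hx i trivial)

/-- A vertex `a` of the cube is the unique maximizer of the functional `2a - 1` on the cube. -/
theorem cube_dotProduct_lt {n : ℕ} {a s : Fin n → ℝ} (ha : a ∈ cube n) (hs : s ∈ cube n)
    (hsa : s ≠ a) : (fun i => 2 * a i - 1) ⬝ᵥ s < (fun i => 2 * a i - 1) ⬝ᵥ a := by
  obtain ⟨j, hj⟩ := Function.ne_iff.mp hsa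
  refine Finset.sum_lt_sum (fun i _ => ?_) ⟨j, Finset.mem_univ j, ?_⟩
  · rcases ha i with h | h <;> rcases hs i with h' | h' <;> norm_num [h, h']
  · rcases ha j with h | h <;> rcases hs j with h' | h' <;> simp_all

theorem IsExposedSubset.trans {n : ℕ} {S T U : Set (Fin n → ℝ)} (hS : S.Finite)
    (hT : IsExposedSubset S T) (hU : IsExposedSubset T U) : IsExposedSubset S U := by
  obtain ⟨hTS, c, γ, hc, hc'⟩ := hT
  obtain ⟨hUT, e, δ, he, he'⟩ := hU
  -- `N + 1` copies of `c` outweigh any gain of `e` over `δ` off `T`.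
  obtain ⟨N, hN⟩ := (hS.image fun s => (e ⬝ᵥ s - δ) / (γ - c ⬝ᵥ s)).bddAbove
  refine ⟨hUT.trans hTS, (N + 1) • c + e, (N + 1) * γ + δ, fun s hs => ?_, fun s hs hsU => ?_⟩
  · rw [add_dotProduct, smul_dotProduct, hc s (hUT hs), he s hs, smul_eq_mul]
  · rw [add_dotProduct, smul_dotProduct, smul_eq_mul]
    by_cases hsT : s ∈ T
    · rw [hc s hsT]
      linarith [he' s hsT hsU]
    · have h1 := hc' s hs hsT
      have h2 : (e ⬝ᵥ s - δ) / (γ - c ⬝ᵥ s) ≤ N := hN ⟨s, hs, rfl⟩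
      rw [div_le_iff₀ (by linarith)] at h2
      nlinarith

/-- The points of `S` seen from `a` under the steepest slope of `h` relative to a functional `g`
that is uniquely maximal at `a` form, together with `a`, an exposed subset. -/
theorem exists_isExposedSubset_slope {n : ℕ} {S : Set (Fin n → ℝ)} (hS : S.Finite)
    {a g : Fin n → ℝ} (hg : ∀ s ∈ S, s ≠ a → g ⬝ᵥ s < g ⬝ᵥ a)
    (hne : ∃ s ∈ S, s ≠ a) (h : Fin n → ℝ) :
    ∃ b ∈ S, b ≠ a ∧
      (∀ s ∈ S, s ≠ a → h ⬝ᵥ (s - a) / g ⬝ᵥ (a - s) ≤ h ⬝ᵥ (b - a) / g ⬝ᵥ (a - b)) ∧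
      IsExposedSubset S
        {s ∈ S | s = a ∨ h ⬝ᵥ (s - a) / g ⬝ᵥ (a - s) = h ⬝ᵥ (b - a) / g ⬝ᵥ (a - b)} := by
  obtain ⟨b, ⟨hb, hba⟩, hmax⟩ := (hS.subset (Set.sdiff_subset (t := {a}))).exists_maximalFor
    (fun s => h ⬝ᵥ (s - a) / g ⬝ᵥ (a - s)) _ (by obtain ⟨s, hs, hsa⟩ := hne; exact ⟨s, hs, hsa⟩)
  have hle : ∀ s ∈ S, s ≠ a →
      h ⬝ᵥ (s - a) / g ⬝ᵥ (a - s) ≤ h ⬝ᵥ (b - a) / g ⬝ᵥ (a - b) := fun s hs hsa =>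
    (le_total _ _).elim id fun h' => hmax ⟨hs, hsa⟩ h'
  refine ⟨b, hb, hba, hle, fun s hs => hs.1, ?_⟩
  set r := h ⬝ᵥ (b - a) / g ⬝ᵥ (a - b)
  -- Tilting `h` by `r • g` turns slope at most `r` into value at most that at `a`.
  have key : ∀ s ∈ S, s ≠ a → (h + r • g) ⬝ᵥ s - (h + r • g) ⬝ᵥ a =
      (h ⬝ᵥ (s - a) / g ⬝ᵥ (a - s) - r) * g ⬝ᵥ (a - s) := by
    intro s hs hsa
    have : g ⬝ᵥ (a - s) ≠ 0 := by
      rw [dotProduct_sub]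
      exact (sub_pos.mpr (hg s hs hsa)).ne'
    rw [sub_mul, div_mul_cancel₀ _ this]
    simp only [add_dotProduct, smul_dotProduct, dotProduct_sub, smul_eq_mul]
    ring
  refine ⟨h + r • g, (h + r • g) ⬝ᵥ a, ?_, ?_⟩
  · rintro s ⟨hs, hsr⟩
    by_cases hsa : s = a
    · rw [hsa]
    · have := key s hs hsa
      rw [hsr.resolve_left hsa, sub_self, zero_mul] at this
      linarith
  · intro s hs hsn
    have hsa : s ≠ a := fun h' => hsn ⟨hs, Or.inl h'⟩
    have hlt := lt_of_le_of_ne (hle s hs hsa) fun h' => hsn ⟨hs, Or.inr h'⟩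
    have hpos : 0 < g ⬝ᵥ (a - s) := by
      rw [dotProduct_sub]
      exact sub_pos.mpr (hg s hs hsa)
    have := mul_neg_of_neg_of_pos (sub_neg.mpr hlt) hpos
    have := key s hs hsa
    linarith

/-- No three vertices of the cube lie on a common ray from one of them. -/
theorem cube_eq_of_proportional {n : ℕ} {a b b' : Fin n → ℝ} (ha : a ∈ cube n)
    (hb : b ∈ cube n) (hb' : b' ∈ cube n) (hba : b ≠ a) {p q : ℝ} (hp : 0 < p) (hq : 0 < q)
    (h : ∀ i, (b i - a i) / p = (b' i - a i) / q) : b = b' := by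
  have h' : ∀ i, (b i - a i) * q = (b' i - a i) * p := fun i =>
    (div_eq_div_iff hp.ne' hq.ne').mp (h i)
  obtain ⟨j, hj⟩ := Function.ne_iff.mp hba
  -- At `j` the nonzero difference from `a` is `±1`, with its sign fixed by `a j`, so it is the same
  -- for `b` and `b'`.
  have hpq : p = q := by
    have := h' j
    rcases ha j with h1 | h1 <;> rcases hb j with h2 | h2 <;> rcases hb' j with h3 | h3 <;>
      rw [h1, h2] at hj <;> rw [h1, h2, h3] at this <;> first | exact absurd rfl hj | linarith
  subst hpq
  funext i
  have := mul_right_cancel₀ hp.ne' (h' i)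
  linarith

/-- A vertex of a set of cube vertices with at least one other point lies on an exposed pair. -/
theorem exists_isExposedSubset_pair {n : ℕ} {S : Set (Fin n → ℝ)} (hS : S ⊆ cube n)
    {a : Fin n → ℝ} (ha : a ∈ S) (hne : ∃ s ∈ S, s ≠ a) :
    ∃ b ∈ S, b ≠ a ∧ IsExposedSubset S {a, b} := by
  have hfin : S.Finite := (cube_finite n).subset hS
  induction hk : S.ncard using Nat.strong_induction_on generalizing S with
  | _ k ih =>
    by_cases hpair : ∃ b ∈ S, b ≠ a ∧ S = {a, b}
    · obtain ⟨b, hb, hba, hSb⟩ := hpair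
      refine ⟨b, hb, hba, hSb.symm.subset, 0, 0, fun _ _ => zero_dotProduct _, fun s hs hs' => ?_⟩
      exact absurd (hSb ▸ hs) hs'
    · obtain ⟨b, hb, hba⟩ := hne
      obtain ⟨b', hb', hb'a, hbb'⟩ : ∃ b' ∈ S, b' ≠ a ∧ b ≠ b' := by
        by_contra! hcon
        refine hpair ⟨b, hb, hba, Set.Subset.antisymm (fun s hs => ?_) ?_⟩
        · by_cases hsa : s = a
          · exact Or.inl hsa
          · exact Or.inr (hcon s hs hsa).symm
        · rintro s (rfl | rfl) <;> assumption
      set g : Fin n → ℝ := fun i => 2 * a i - 1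
      have hg : ∀ s ∈ S, s ≠ a → g ⬝ᵥ s < g ⬝ᵥ a := fun s hs hsa =>
        cube_dotProduct_lt (hS ha) (hS hs) hsa
      have hpos : ∀ s ∈ S, s ≠ a → 0 < g ⬝ᵥ (a - s) := fun s hs hsa => by
        rw [dotProduct_sub]
        exact sub_pos.mpr (hg s hs hsa)
      -- The steepest face for coordinate `i` cannot contain both `b` and `b'`, so it is smaller
      -- than `S` and the induction applies.
      obtain ⟨i, hi⟩ : ∃ i, (b i - a i) / g ⬝ᵥ (a - b) ≠ (b' i - a i) / g ⬝ᵥ (a - b') := by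
        by_contra! hcon
        exact hbb' (cube_eq_of_proportional (hS ha) (hS hb) (hS hb') hba (hpos b hb hba)
          (hpos b' hb' hb'a) hcon)
      obtain ⟨t, ht, hta, -, hexp⟩ :=
        exists_isExposedSubset_slope hfin hg ⟨b, hb, hba⟩ (Pi.single i 1)
      set U := {s ∈ S | s = a ∨ (Pi.single i 1 : Fin n → ℝ) ⬝ᵥ (s - a) / g ⬝ᵥ (a - s) =
        (Pi.single i 1 : Fin n → ℝ) ⬝ᵥ (t - a) / g ⬝ᵥ (a - t)} with hU
      have hUS : U ⊂ S := by
        refine ⟨fun s hs => hs.1, fun hSU => hi ?_⟩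
        have h1 := (hSU hb).2.resolve_left hba
        have h2 := (hSU hb').2.resolve_left hb'a
        simp only [single_one_dotProduct, Pi.sub_apply] at h1 h2
        rw [h1, h2]
      obtain ⟨w, hw, hwa, hwexp⟩ := ih U.ncard (hk ▸ Set.ncard_lt_ncard hUS hfin)
        (hUS.1.trans hS) ⟨ha, Or.inl rfl⟩ ⟨t, ⟨ht, Or.inr rfl⟩, hta⟩ (hfin.subset hUS.1) rfl
      exact ⟨w, hw.1, hwa, hexp.trans hfin hwexp⟩

/-- A vertex that does not maximize `c` has an improving edge. -/
theorem exists_isExposedSubset_pair_improving {n : ℕ} {S : Set (Fin n → ℝ)} (hS : S ⊆ cube n)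
    {a c : Fin n → ℝ} (ha : a ∈ S) (hc : ∃ s ∈ S, c ⬝ᵥ a < c ⬝ᵥ s) :
    ∃ b ∈ S, c ⬝ᵥ a < c ⬝ᵥ b ∧ IsExposedSubset S {a, b} := by
  have hfin : S.Finite := (cube_finite n).subset hS
  set g : Fin n → ℝ := fun i => 2 * a i - 1
  have hg : ∀ s ∈ S, s ≠ a → g ⬝ᵥ s < g ⬝ᵥ a := fun s hs hsa =>
    cube_dotProduct_lt (hS ha) (hS hs) hsa
  have hpos : ∀ s ∈ S, s ≠ a → 0 < g ⬝ᵥ (a - s) := fun s hs hsa => by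
    rw [dotProduct_sub]
    exact sub_pos.mpr (hg s hs hsa)
  obtain ⟨s, hs, hcs⟩ := hc
  have hsa : s ≠ a := by
    rintro rfl
    exact lt_irrefl _ hcs
  obtain ⟨t, ht, hta, hmax, hexp⟩ := exists_isExposedSubset_slope hfin hg ⟨s, hs, hsa⟩ c
  -- The maximal slope is positive, so every edge at `a` within the steepest face improves `c`.
  have hr : 0 < c ⬝ᵥ (t - a) / g ⬝ᵥ (a - t) :=
    (div_pos (by rw [dotProduct_sub]; exact sub_pos.mpr hcs) (hpos s hs hsa)).trans_le
      (hmax s hs hsa)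
  obtain ⟨b, hb, hba, hbexp⟩ := exists_isExposedSubset_pair
    (S := {s ∈ S | s = a ∨ c ⬝ᵥ (s - a) / g ⬝ᵥ (a - s) = c ⬝ᵥ (t - a) / g ⬝ᵥ (a - t)})
    (fun s hs => hS hs.1) ⟨ha, Or.inl rfl⟩ ⟨t, ⟨ht, Or.inr rfl⟩, hta⟩
  refine ⟨b, hb.1, ?_, hexp.trans hfin hbexp⟩
  rw [← hb.2.resolve_left hba, div_pos_iff_of_pos_right (hpos b hb.1 hba), dotProduct_sub] at hr
  exact sub_pos.mp hr

/-! ### From exposed subsets to faces and the polytope graph -/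

theorem dotProduct_le_of_mem_convexHull {n : ℕ} {S : Set (Fin n → ℝ)} {c : Fin n → ℝ} {γ : ℝ}
    (h : ∀ s ∈ S, c ⬝ᵥ s ≤ γ) {x : Fin n → ℝ} (hx : x ∈ convexHull ℝ S) : c ⬝ᵥ x ≤ γ :=
  convexHull_min (t := {x | c ⬝ᵥ x ≤ γ}) h
    (convex_halfSpace_le ⟨dotProduct_add c, fun r x => dotProduct_smul r c x⟩ γ) hx

theorem dotProduct_lt_of_mem_convexHull {n : ℕ} {S : Set (Fin n → ℝ)} {c : Fin n → ℝ} {γ : ℝ}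
    (h : ∀ s ∈ S, c ⬝ᵥ s < γ) {x : Fin n → ℝ} (hx : x ∈ convexHull ℝ S) : c ⬝ᵥ x < γ :=
  convexHull_min (t := {x | c ⬝ᵥ x < γ}) h
    (convex_halfSpace_lt ⟨dotProduct_add c, fun r x => dotProduct_smul r c x⟩ γ) hx

theorem IsExposedSubset.isFace_convexHull {n : ℕ} {S T : Set (Fin n → ℝ)}
    (h : IsExposedSubset S T) : IsFace (convexHull ℝ S) (convexHull ℝ T) := by
  obtain ⟨hTS, c, γ, hc, hc'⟩ := h
  have hle : ∀ x ∈ convexHull ℝ T, c ⬝ᵥ x = γ := fun x hx =>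
    convexHull_min (t := {x | c ⬝ᵥ x = γ}) hc
      (convex_hyperplane ⟨dotProduct_add c, fun r x => dotProduct_smul r c x⟩ γ) hx
  refine ⟨c, γ, fun x hx => dotProduct_le_of_mem_convexHull (fun s hs => ?_) hx, ?_⟩
  · by_cases hsT : s ∈ T
    · exact (hc s hsT).le
    · exact (hc' s hs hsT).le
  · refine Set.Subset.antisymm (fun x hx => ⟨convexHull_mono hTS hx, hle x hx⟩) ?_
    rintro x ⟨hx, hxγ⟩
    -- This set contains `S` and is convex: a proper mixture involving a point strictly below `γ`
    -- stays strictly below.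
    have hK : x ∈ {x | c ⬝ᵥ x < γ ∨ x ∈ convexHull ℝ T} := by
      refine convexHull_min (fun s hs => ?_) ?_ hx
      · by_cases hsT : s ∈ T
        · exact Or.inr (subset_convexHull ℝ T hsT)
        · exact Or.inl (hc' s hs hsT)
      · rw [convex_iff_forall_pos]
        intro y hy z hz p q hp hq hpq
        have hcomb : c ⬝ᵥ (p • y + q • z) = p * c ⬝ᵥ y + q * c ⬝ᵥ z := by
          simp [dotProduct_add, dotProduct_smul]
        have hγ : γ = p * γ + q * γ := by rw [← add_mul, hpq, one_mul]
        rcases hy with hy | hy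
        · refine Or.inl ?_
          have hz' : c ⬝ᵥ z ≤ γ := hz.elim le_of_lt fun h => (hle z h).le
          rw [hcomb, hγ]
          exact add_lt_add_of_lt_of_le (mul_lt_mul_of_pos_left hy hp)
            (mul_le_mul_of_nonneg_left hz' hq.le)
        · rcases hz with hz | hz
          · refine Or.inl ?_
            rw [hcomb, hγ]
            exact add_lt_add_of_le_of_lt (mul_le_mul_of_nonneg_left (hle y hy).le hp.le)
              (mul_lt_mul_of_pos_left hz hq)
          · exact Or.inr (convex_convexHull ℝ T hy hz hp.le hq.le hpq)
    exact hK.resolve_left hxγ.not_lt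

theorem polytopeVertices_convexHull {n : ℕ} {S : Set (Fin n → ℝ)} (hS : S ⊆ cube n) :
    polytopeVertices (convexHull ℝ S) = S := by
  ext v
  constructor
  · rintro ⟨⟨c, γ, hle, hface⟩, -, -⟩
    by_contra hv
    have hvm : v ∈ {x ∈ convexHull ℝ S | c ⬝ᵥ x = γ} := hface ▸ rfl
    refine (dotProduct_lt_of_mem_convexHull (fun s hs => ?_) hvm.1).ne hvm.2
    refine lt_of_le_of_ne (hle s (subset_convexHull ℝ S hs)) fun hsγ => hv ?_
    have : s ∈ ({v} : Set (Fin n → ℝ)) := hface ▸ ⟨subset_convexHull ℝ S hs, hsγ⟩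
    exact (Set.mem_singleton_iff.mp this) ▸ hs
  · intro hv
    refine ⟨?_, Set.singleton_nonempty v, ?_⟩
    · have : IsExposedSubset S {v} := ⟨Set.singleton_subset_iff.mpr hv, fun i => 2 * v i - 1, _,
        fun s hs => by rw [Set.mem_singleton_iff.mp hs],
        fun s hs hsv => cube_dotProduct_lt (hS hv) (hS hs) hsv⟩
      simpa using this.isFace_convexHull
    · rw [direction_affineSpan, vectorSpan_singleton, finrank_bot]

theorem IsExposedSubset.adj_polytopeGraph {n : ℕ} {S : Set (Fin n → ℝ)} (hS : S ⊆ cube n)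
    {a b : Fin n → ℝ} (hab : a ≠ b) (h : IsExposedSubset S {a, b}) :
    (polytopeGraph (convexHull ℝ S)).Adj a b := by
  have hV := polytopeVertices_convexHull hS
  refine ⟨hV.superset (h.1 (Or.inl rfl)), hV.superset (h.1 (Or.inr rfl)), ?_, ⟨a, left_mem_segment ℝ a b⟩, ?_⟩
  · rw [← convexHull_pair]
    exact h.isFace_convexHull
  · rw [← convexHull_pair, affineSpan_convexHull, direction_affineSpan, vectorSpan_pair,
      vsub_eq_sub]
    exact finrank_span_singleton (sub_ne_zero.mpr hab)

theorem eq_or_eq_of_mem_segment_of_mem_cube {n : ℕ} {u v w : Fin n → ℝ} (hu : u ∈ cube n)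
    (hv : v ∈ cube n) (hw : w ∈ cube n) (h : w ∈ segment ℝ u v) : w = u ∨ w = v := by
  by_contra! hcon
  rw [← convexHull_pair] at h
  refine (dotProduct_lt_of_mem_convexHull (c := fun i => 2 * w i - 1) ?_ h).ne rfl
  rintro s (rfl | rfl)
  · exact cube_dotProduct_lt hw hu hcon.1.symm
  · exact cube_dotProduct_lt hw hv hcon.2.symm

/-! ### Lifting to edges of `P` -/

theorem projFirst_mem_cube {d n : ℕ} (h : d ≤ n) {x : Fin n → ℝ} (hx : x ∈ cube n) :
    projFirst h x ∈ cube d := fun i => hx (Fin.castLE h i)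

/-- Linear functionals pull back along the projection. -/
theorem exists_dotProduct_eq_dotProduct_projFirst {d n : ℕ} (h : d ≤ n) (c : Fin d → ℝ) :
    ∃ c' : Fin n → ℝ, ∀ x, c' ⬝ᵥ x = c ⬝ᵥ projFirst h x := by
  refine ⟨Matrix.vecMul c (LinearMap.toMatrix' (projFirst h)), fun x => ?_⟩
  rw [← Matrix.dotProduct_mulVec, LinearMap.toMatrix'_mulVec]

theorem encard_mixedFibers_le {d n : ℕ} (h : d ≤ n) {S A : Set (Fin n → ℝ)} (hS : S ⊆ cube n)
    (hA : A ⊆ S) : (mixedFibers h (convexHull ℝ S) A).encard ≤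
      numEdgesBetween (polytopeGraph (convexHull ℝ S)) A (S \ A) := by
  -- Points of `M` are encoded as loops, the images of edges lying inside a fiber.
  have hinj : Function.Injective (fun x : Fin d → ℝ => s(x, x)) := Sym2.diag_injective
  rw [← hinj.encard_image]
  refine le_trans (Set.encard_le_encard ?_) (Set.encard_image_le (Sym2.map (projFirst h)) _)
  rintro _ ⟨x, ⟨hx, ⟨a, ⟨hax, -⟩, haA⟩, ⟨w, ⟨hwx, -⟩, hw⟩⟩, rfl⟩
  rw [polytopeVertices_convexHull hS] at hw
  set T := {s ∈ S | projFirst h s = x} with hT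
  have hTS : T ⊆ S := fun s hs => hs.1
  have hexp : IsExposedSubset S T := by
    obtain ⟨c, hc⟩ := exists_dotProduct_eq_dotProduct_projFirst h (fun i => 2 * x i - 1)
    refine ⟨hTS, c, (fun i => 2 * x i - 1) ⬝ᵥ x, fun s hs => ?_, fun s hs hsT => ?_⟩
    · rw [hc, hs.2]
    · rw [hc]
      exact cube_dotProduct_lt hx (projFirst_mem_cube h (hS hs)) fun hsx => hsT ⟨hs, hsx⟩
  -- As `a'` is best within `T ∩ A` while `w` is better still, any improving edge from `a'` in `T`
  -- leaves `A`.
  obtain ⟨a', ⟨ha'T, ha'A⟩, hmax⟩ := (((cube_finite n).subset hS).subset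
    (Set.inter_subset_left.trans hTS : T ∩ A ⊆ S)).exists_maximalFor
    (fun s => (fun i => 2 * w i - 1) ⬝ᵥ s) _ ⟨a, ⟨hA haA, hax⟩, haA⟩
  have ha'w : a' ≠ w := fun h' => hw.2 (h' ▸ ha'A)
  obtain ⟨b, hb, hlt, hbexp⟩ := exists_isExposedSubset_pair_improving (hTS.trans hS) ha'T
    ⟨w, ⟨hw.1, hwx⟩, cube_dotProduct_lt (hS hw.1) (hS ha'T.1) ha'w⟩
  have hbA : b ∉ A := fun hbA => (hmax ⟨hb, hbA⟩ hlt.le).not_gt hlt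
  have hne : a' ≠ b := fun h' => hbA (h' ▸ ha'A)
  refine ⟨s(a', b), ⟨?_, a', ha'A, b, ⟨hb.1, hbA⟩, rfl⟩, ?_⟩
  · exact (hexp.trans ((cube_finite n).subset hS) hbexp).adj_polytopeGraph hS hne
  · rw [Sym2.map_mk, ha'T.2, hb.2]

theorem numEdgesBetween_image_projFirst_le {d n : ℕ} (h : d ≤ n) {S A : Set (Fin n → ℝ)}
    (hS : S ⊆ cube n) (hA : A ⊆ S) :
    numEdgesBetween (polytopeGraph (convexHull ℝ (projFirst h '' S))) (projFirst h '' A)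
      (projFirst h '' S \ projFirst h '' A) ≤
      numEdgesBetween (polytopeGraph (convexHull ℝ S)) A (S \ A) := by
  refine le_trans (Set.encard_le_encard ?_) (Set.encard_image_le (Sym2.map (projFirst h)) _)
  rintro _ ⟨hadj, _, ⟨a, ha, rfl⟩, _, ⟨⟨w, hw, rfl⟩, hwB⟩, rfl⟩
  set u := projFirst h a
  set v := projFirst h w
  have huv : u ≠ v := fun h' => hwB ⟨a, ha, h'⟩
  have hu : u ∈ cube d := projFirst_mem_cube h (hS (hA ha))
  have hv : v ∈ cube d := projFirst_mem_cube h (hS hw)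
  obtain ⟨-, -, ⟨e, γ, hle, hface⟩, -, -⟩ := hadj
  set T := {s ∈ S | projFirst h s = u ∨ projFirst h s = v}
  have hTS : T ⊆ S := fun s hs => hs.1
  have hexp : IsExposedSubset S T := by
    obtain ⟨c, hc⟩ := exists_dotProduct_eq_dotProduct_projFirst h e
    refine ⟨hTS, c, γ, fun s hs => ?_, fun s hs hsT => ?_⟩
    · have : projFirst h s ∈ segment ℝ u v := by
        rcases hs.2 with h' | h' <;> rw [h']
        exacts [left_mem_segment ℝ u v, right_mem_segment ℝ u v]
      rw [hface] at this
      rw [hc, this.2]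
    · have hmem := subset_convexHull ℝ _ (Set.mem_image_of_mem (projFirst h) hs)
      rw [hc]
      refine lt_of_le_of_ne (hle _ hmem) fun hγ => hsT ⟨hs, ?_⟩
      refine eq_or_eq_of_mem_segment_of_mem_cube hu hv (projFirst_mem_cube h (hS hs)) ?_
      rw [hface]
      exact ⟨hmem, hγ⟩
  -- This functional is constant on the vertices over `u`, so improving forces a move to `v`.
  obtain ⟨c, hc⟩ := exists_dotProduct_eq_dotProduct_projFirst h (fun i => 2 * v i - 1)
  obtain ⟨b, hb, hlt, hbexp⟩ := exists_isExposedSubset_pair_improving (c := c) (hTS.trans hS)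
    (a := a) ⟨hA ha, Or.inl rfl⟩ ⟨w, ⟨hw, Or.inr rfl⟩, by
      rw [hc, hc]
      exact cube_dotProduct_lt hv hu huv⟩
  have hbv : projFirst h b = v := hb.2.resolve_left fun hbu => by
    rw [hc, hc, hbu] at hlt
    exact lt_irrefl _ hlt
  have hbA : b ∉ A := fun hbA => hwB ⟨b, hbA, hbv⟩
  have hne : a ≠ b := fun h' => hbA (h' ▸ ha)
  refine ⟨s(a, b), ⟨?_, a, ha, b, ⟨hb.1, hbA⟩, rfl⟩, ?_⟩
  · exact (hexp.trans ((cube_finite n).subset hS) hbexp).adj_polytopeGraph hS hne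
  · rw [Sym2.map_mk, hbv]

theorem lemma2p6 (d n : ℕ) (hdn : d < n) (P : Set (Fin n → ℝ)) (hP : IsZeroOnePolytope P)
    (R : Set (Fin d → ℝ)) (hR : R = projFirst hdn.le '' P)
    (A : Set (Fin n → ℝ)) (hA : A ⊆ polytopeVertices P)
    (B : Set (Fin d → ℝ)) (hB : B = projFirst hdn.le '' A) :
    max (mixedFibers hdn.le P A).encard
        (numEdgesBetween (polytopeGraph R) B (polytopeVertices R \ B)) ≤
      numEdgesBetween (polytopeGraph P) A (polytopeVertices P \ A) := by
  obtain ⟨S, hS, rfl⟩ := hP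
  have hπS : projFirst hdn.le '' S ⊆ cube d := by
    rintro _ ⟨s, hs, rfl⟩
    exact projFirst_mem_cube hdn.le (hS hs)
  rw [(projFirst hdn.le).image_convexHull] at hR
  subst hR hB
  rw [polytopeVertices_convexHull hS] at hA ⊢
  rw [polytopeVertices_convexHull hπS]
  exact max_le (encard_mixedFibers_le hdn.le hS hA)
    (numEdgesBetween_image_projFirst_le hdn.le hS hA)
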